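/- Let $k \ge 2$ be an integer. **The class $\mathsf{Mod}_k\mathsf P$.** $\#\mathsf P$ is the set of functions $f:\{0,1\}^*\to\mathbb N$ for which there is a nondeterministic polynomial-time Turing machine $\mathbf N$ such that, for every $x$, $f(x)$ is the number of accepting computational branches of $\mathbf N$ on input $x$. $\mathsf{Mod}_k\mathsf P$ is the set of languages $L\subseteq\{0,1\}^*$ for which there is $f\in\#\mathsf P$ such that, for all $x$, $x\in L$ if and only if $f(x)\not\equiv 0 \pmod k$. **The class $\mathsf{GLP}_{\mathbb Z_k}$.** For $N\ge 0$ identify the functions $\{0,1\}^N\to\mathbb Z_k$ with $(\mathbb Z_k^{\{0,1\}})^{\otimes N}$, and write $|x\rangle$, $x\in\{0,1\}^N$, for the standard basis vectors. An invertible $\mathbb Z_k$-circuit on $n$ input bits is a finite sequence of operations, performed one after the other, each of which is either a preparation $|\psi\rangle\mapsto|\psi\rangle|0\rangle$ of a fresh bit, or an invertible gate: an invertible $2^h\times 2^h$ matrix over $\mathbb Z_k$, $1\le h\le 4$, acting on $h$ distinct bits among those present, in tensor product with the identity on all other bits. A family $\{C_n\}_{n\ge1}$ of such circuits, $C_n$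 on $n$ input bits, is polynomial-time uniform if a deterministic Turing machine computes a description of $C_n$ from the input $1^n$ in time polynomial in $n$ (so that $C_n$ has polynomially many preparations and gates). Write $L(x)=1$ if $x\in L$ and $L(x)=0$ otherwise. $\mathsf{GLP}_{\mathbb Z_k}$ is the set of languages $L\subseteq\{0,1\}^*$ for which there is a polynomial-time uniform family $\{C_n\}_{n\ge1}$ of invertible $\mathbb Z_k$-circuits such that for all $n\ge1$ and all $x\in\{0,1\}^n$ there is a vector $|\psi\rangle$ with $C_n|x\rangle=|\psi\rangle|L(x)\rangle$. **Lemma.** For every integer $k\ge 2$, $\mathsf{GLP}_{\mathbb Z_k}\subseteq\mathsf{Mod}_k\mathsf P$. More precisely, for every $L\in\mathsf{GLP}_{\mathbb Z_k}$ there is $f\in\#\mathsf P$ such that, for all $x\in\{0,1\}^*$, $f(x)\equiv 1\pmod k$ if $x\in L$ and $f(x)\equiv 0\pmod k$ if $x\notin L$. -/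

import Mathlib

open Turing

namespace Modal

/-! ### Nondeterministic Turing machines, `#P` and `Mod_k P` -/

/-- A nondeterministic multi-stack Turing machine: the nondeterministic version of Mathlib's
`Turing.FinTM2`. With finitely many stacks, finite alphabets, finitely many labels and finitely many
internal states, it is the classical multi-tape machine (a tape is a pair of stacks) up to a constant
factor in the running time. To each label is attached a finite list of possible transitions (a
`Turing.TM2.Stmt` each), one of which is chosen nondeterministically in each step. A branch halts
when it reaches the label `none`; it then accepts or rejects according to its internal state. -/
structure NTM where
  /-- index type of the stacks -/
  {K : Type}
  [decK : DecidableEq K]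
  [finK : Finite K]
  /-- the input stack -/
  k₀ : K
  /-- the stack alphabets -/
  Γ : K → Type
  [finΓ : ∀ k, Finite (Γ k)]
  /-- inputs are strings over `{0,1}` -/
  inputAlphabet : Γ k₀ ≃ Bool
  /-- the labels -/
  Λ : Type
  [finΛ : Finite Λ]
  /-- the initial label -/
  main : Λ
  /-- the internal states -/
  σ : Type
  [finσ : Finite σ]
  /-- the initial internal state -/
  initialState : σ
  /-- the possible transitions at each label -/
  m : Λ → List (TM2.Stmt Γ Λ σ)
  /-- the internal states that are accepting when the machine halts -/
  accept : Set σ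

namespace NTM

/-- Configurations: a label (or `none` when halted), an internal state, and the stacks. -/
abbrev Cfg (M : NTM) : Type := TM2.Cfg M.Γ M.Λ M.σ

/-- The list of possible successors of a configuration (none if the machine has halted). -/
def step (M : NTM) : M.Cfg → List M.Cfg
  | ⟨none, _, _⟩ => []
  | ⟨some l, v, S⟩ =>
    (M.m l).map fun q => @TM2.stepAux M.K M.Γ M.Λ M.σ M.decK q v S

/-- The initial configuration: the input on the input stack, all other stacks empty. -/
def init (M : NTM) (x : List Bool) : M.Cfg where
  l := some M.main
  var := M.initialState
  stk := @Function.update M.K (fun k => List (M.Γ k)) M.decK (fun _ => [])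
    M.k₀ (x.map M.inputAlphabet.symm)

/-- The configuration reached by following a sequence of nondeterministic choices, where choice `i`
selects the `i`-th possible successor; `none` if some choice does not exist. -/
def follow (M : NTM) : List ℕ → M.Cfg → Option M.Cfg
  | [], c => some c
  | i :: w, c => (M.step c)[i]?.bind (M.follow w)

/-- On every input `x`, every branch of `M` ends after at most `t |x|` steps. -/
def RunsInTime (M : NTM) (t : ℕ → ℕ) : Prop :=
  ∀ (x : List Bool) (w : List ℕ), (M.follow w (M.init x)).isSome → w.length ≤ t x.length

/-- The accepting branches of `M` on input `x`, as sequences of nondeterministic choices. -/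
def acceptingBranches (M : NTM) (x : List Bool) : Set (List ℕ) :=
  {w | ∃ c, M.follow w (M.init x) = some c ∧ c.l = none ∧ c.var ∈ M.accept}

end NTM

/-- `#P`: the functions that count the accepting branches of a nondeterministic polynomial-time
Turing machine. -/
def SharpP : Set (List Bool → ℕ) :=
  {f | ∃ (M : NTM) (p : Polynomial ℕ), M.RunsInTime (fun n => p.eval n) ∧
    ∀ x, f x = (M.acceptingBranches x).ncard}

/-- `Mod_k P`: the languages `L` for which there is `f ∈ #P` such that `x ∈ L` iff
`f x` is not divisible by `k`. -/
def ModP (k : ℕ) : Set (Language Bool) :=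
  {L | ∃ f ∈ SharpP, ∀ x, x ∈ L ↔ ¬ f x ≡ 0 [MOD k]}

/-! ### Invertible `ℤ_k`-modal circuits -/

/-- The space of `ℤ_k`-distributions over bit strings of all lengths. -/
abbrev Dist (k : ℕ) : Type := List Bool →₀ ZMod k

/-- The standard basis state `|x⟩`. -/
noncomputable def ket (k : ℕ) (x : List Bool) : Dist k := Finsupp.single x 1

/-- The linear map `ψ ↦ ψ ⊗ |b⟩`. -/
noncomputable def appendBit (k : ℕ) (b : Bool) : Dist k →ₗ[ZMod k] Dist k :=
  Finsupp.lmapDomain (ZMod k) (ZMod k) fun x => x ++ [b]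

/-- The substring of `x` at the positions `pos`. -/
def readBits {h : ℕ} (pos : Fin h → ℕ) (x : List Bool) : Fin h → Bool :=
  fun j => x.getD (pos j) false

/-- The string `x` with the bits at the positions `pos` replaced by `y`. -/
def writeBits {h : ℕ} (pos : Fin h → ℕ) (y : Fin h → Bool) (x : List Bool) : List Bool :=
  (List.finRange h).foldl (fun z j => z.set (pos j) (y j)) x

/-- The invertible gates on `h` bits: invertible `2^h × 2^h` matrices over `ℤ_k`, with rows and
columns indexed by `{0,1}^h`. -/
abbrev Gate (k h : ℕ) : Type := Matrix.GeneralLinearGroup (Fin h → Bool) (ZMod k)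

/-- A gate acting on the bits at the positions `pos`, tensored with the identity on all others:
`|x⟩ ↦ ∑ y, ⟨y|M|x_pos⟩ |x with its bits at pos replaced by y⟩`. -/
noncomputable def gateMap {k h : ℕ} (M : Gate k h) (pos : Fin h → ℕ) :
    Dist k →ₗ[ZMod k] Dist k :=
  Finsupp.linearCombination (ZMod k) fun x =>
    ∑ y : Fin h → Bool, (M : Matrix (Fin h → Bool) (Fin h → Bool) (ZMod k)) y (readBits pos x) •
      ket k (writeBits pos y x)

/-- The primitive operations: preparation of a fresh bit `|0⟩`, adjoined as the last bit, and
invertible gates on at most four bits (`gate h M pos` acts on `h + 1` bits, where `h < 4`). -/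
inductive Op (k : ℕ) : Type
  | prep : Op k
  | gate (h : Fin 4) (M : Gate k (h + 1)) (pos : Fin (h + 1) → ℕ) : Op k

/-- The linear transformation performed by a primitive operation. -/
noncomputable def Op.toLin {k : ℕ} : Op k → Dist k →ₗ[ZMod k] Dist k
  | .prep => appendBit k false
  | .gate _ M pos => gateMap M pos

/-- A circuit is a sequence of primitive operations, the first one being performed first. -/
abbrev Circuit (k : ℕ) : Type := List (Op k)

/-- The linear transformation performed by a circuit. -/
noncomputable def Circuit.toLin {k : ℕ} : Circuit k → Dist k →ₗ[ZMod k] Dist k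
  | [] => LinearMap.id
  | o :: C => (Circuit.toLin C).comp o.toLin

/-- The circuit makes sense on `n` input bits: each gate acts on distinct positions among the
bits present when it is performed. -/
def Circuit.WellFormed {k : ℕ} : ℕ → Circuit k → Prop
  | _, [] => True
  | n, .prep :: C => Circuit.WellFormed (n + 1) C
  | n, .gate _ _ pos :: C =>
    (Function.Injective pos ∧ ∀ j, pos j < n) ∧ Circuit.WellFormed n C

/-- The alphabet for descriptions of circuits. It is finite for `k ≥ 1`, since there are finitely
many gates on at most four bits. -/
inductive Sym (k : ℕ) : Type
  | prep : Sym k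
  | gate (h : Fin 4) (M : Gate k (h + 1)) : Sym k
  | one : Sym k
  | sep : Sym k

/-- The description of a primitive operation: the positions that a gate acts on are
written in unary, each followed by a separator. -/
def Op.encode {k : ℕ} : Op k → List (Sym k)
  | .prep => [.prep]
  | .gate h M pos =>
    .gate h M :: (List.finRange (h + 1)).flatMap fun j => List.replicate (pos j) .one ++ [.sep]

/-- The description of a circuit. -/
def Circuit.encode {k : ℕ} (C : Circuit k) : List (Sym k) := C.flatMap Op.encode

/-- The circuit family `C₁, C₂, …` is polynomial-time uniform: a deterministic Turing machine with
finite alphabets computes the description of `Cₙ` from `1ⁿ` in time polynomial in `n`. In particular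
the number of operations in `Cₙ`, preparations and gates, is polynomially bounded in `n`. -/
def PolyTimeUniform {k : ℕ} (C : ℕ+ → Circuit k) : Prop :=
  ∃ T : TM2ComputableInPolyTime (fun n : ℕ+ => List.replicate n true) Circuit.encode C,
    ∀ i, Finite (T.tm.Γ i)

open scoped Classical in
/-- `GLP[ℤ_k]`: the languages `L` which are decided exactly by a polynomial-time uniform family of
invertible `ℤ_k`-modal circuits, in the sense that `Cₙ|x⟩ = |ψ⟩|L(x)⟩` for each `x ∈ {0,1}ⁿ`. -/
def GLP (k : ℕ) : Set (Language Bool) :=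
  {L | ∃ C : ℕ+ → Circuit k, PolyTimeUniform C ∧ ∀ n : ℕ+, Circuit.WellFormed n (C n) ∧
    ∀ x : List Bool, x.length = n →
      ∃ ψ : Dist k, Circuit.toLin (C n) (ket k x) = appendBit k (decide (x ∈ L)) ψ}

end Modal

/-! A language `L ∈ GLP k` is decided by circuits `C` with `C|x⟩ = ψ ⊗ |L(x)⟩`. The weighted number
of paths of `C` from `x` that end in a string with last bit `1` is a sum of coefficients of `ψ` and
need not be `L(x)`, since these coefficients are arbitrary. So the output is paired with a covector
that is computed alongside: a second register, also initially `x`, undergoes the same preparations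
and the gates `(M⁻¹)ᵀ` in place of `M`. The standard pairing of the two registers is preserved
(`pairSum_one`), so it is `⟨x|x⟩ = 1` at the end. If only final strings with last bit `1` are allowed
to contribute, then all of the pairing is kept when `L(x) = 1`, and nothing when `L(x) = 0`
(`pairSum_of_toLin_eq`). Compared to undoing the circuit after its last bit has been tested, this has
the advantage that the description of `C` is read only once.

The weighted number of pairs of paths that meet in a string with last bit `1` is counted by a
nondeterministic machine (`simulator`). It writes `1ⁿ`, runs the given machine to obtain the
description of `C`, and processes the description symbol by symbol. The two registers are stored as
one list of pairs of bits, split at a cursor into two stacks. At a gate the machine guesses old and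
new bits for both registers, each guess with multiplicity its weight, and rejects if it finds other
old bits (`counts_circuit`). Accepting branches are counted backwards from the halting configurations
by `NTM.Counts.step`. The circuits say nothing about the empty input, for which the answer is built
into the machine. Running times are polynomial because a machine pushes boundedly many symbols in
each step (`exists_length_output_le`). -/

namespace Modal

section

/-! ### Counting accepting branches by backward induction -/

namespace NTM

variable (M : NTM)

/-- The accepting branches of `M` that start at the configuration `c`. -/
def acceptingFrom (c : M.Cfg) : Set (List ℕ) :=
  {w | ∃ c', M.follow w c = some c' ∧ c'.l = none ∧ c'.var ∈ M.accept}

/-- From the configuration `c`, every branch of `M` ends after at most `t` steps, and the number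
of accepting branches is `a` modulo `k`. -/
structure Counts (k : ℕ) (c : M.Cfg) (t : ℕ) (a : ZMod k) : Prop where
  bound : ∀ w, (M.follow w c).isSome → w.length ≤ t
  finite : (M.acceptingFrom c).Finite
  count : ((M.acceptingFrom c).ncard : ZMod k) = a

variable {M} {k : ℕ}

theorem Counts.mono {c : M.Cfg} {t t' : ℕ} {a : ZMod k} (h : M.Counts k c t a) (ht : t ≤ t') :
    M.Counts k c t' a :=
  ⟨fun w hw => (h.bound w hw).trans ht, h.finite, h.count⟩

theorem acceptingFrom_of_none {v : M.σ} {S : ∀ i, List (M.Γ i)} :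
    M.acceptingFrom ⟨none, v, S⟩ = {w | w = [] ∧ v ∈ M.accept} := by
  ext w
  cases w with
  | nil => simp [acceptingFrom, follow]
  | cons i w => simp [acceptingFrom, follow, step]

theorem Counts.halted_accept {v : M.σ} {S : ∀ i, List (M.Γ i)} (t : ℕ) (hv : v ∈ M.accept) :
    M.Counts k ⟨none, v, S⟩ t 1 := by
  have h : M.acceptingFrom ⟨none, v, S⟩ = {[]} := by
    rw [acceptingFrom_of_none]; ext; simp [hv]
  refine ⟨fun w hw => ?_, by simp [h], by simp [h]⟩
  cases w with
  | nil => simp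
  | cons i w => simp [follow, step] at hw

theorem Counts.halted_reject {v : M.σ} {S : ∀ i, List (M.Γ i)} (t : ℕ) (hv : v ∉ M.accept) :
    M.Counts k ⟨none, v, S⟩ t 0 := by
  have h : M.acceptingFrom ⟨none, v, S⟩ = ∅ := by
    rw [acceptingFrom_of_none]; ext; simp [hv]
  refine ⟨fun w hw => ?_, by simp [h], by simp [h]⟩
  cases w with
  | nil => simp
  | cons i w => simp [follow, step] at hw

theorem acceptingFrom_of_some {l : M.Λ} {v : M.σ} {S : ∀ i, List (M.Γ i)} :
    M.acceptingFrom ⟨some l, v, S⟩ =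
      {w | ∃ i w' c', w = i :: w' ∧ (M.step ⟨some l, v, S⟩)[i]? = some c' ∧
        w' ∈ M.acceptingFrom c'} := by
  ext w
  cases w with
  | nil => simp [acceptingFrom, follow]
  | cons i w =>
    simp only [acceptingFrom, follow, Set.mem_ofPred_eq, Option.bind_eq_some_iff, List.cons.injEq]
    constructor
    · rintro ⟨c', ⟨d, hd, h1⟩, h2⟩
      exact ⟨i, w, d, ⟨rfl, rfl⟩, hd, c', h1, h2⟩
    · rintro ⟨_, _, d, ⟨rfl, rfl⟩, hd, c', h1, h2⟩
      exact ⟨c', ⟨d, hd, h1⟩, h2⟩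

/-- The count at a branching configuration is the sum of the counts at its successors. -/
theorem Counts.step {ι : Type*} {l : M.Λ} {v : M.σ} {S : ∀ i, List (M.Γ i)} (is : List ι)
    (F : ι → M.Cfg) (hF : M.step ⟨some l, v, S⟩ = is.map F) {t : ℕ} {g : ι → ZMod k}
    (h : ∀ i ∈ is, M.Counts k (F i) t (g i)) :
    M.Counts k ⟨some l, v, S⟩ (t + 1) (is.map g).sum := by
  have key : M.acceptingFrom ⟨some l, v, S⟩ =
      ⋃ i : Fin is.length, (List.cons i.1) '' M.acceptingFrom (F is[i]) := by
    rw [acceptingFrom_of_some, hF]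
    ext w
    simp only [Set.mem_ofPred_eq, Set.mem_iUnion, Set.mem_image, List.getElem?_map,
      Option.map_eq_some_iff, List.getElem?_eq_some_iff]
    constructor
    · rintro ⟨i, w', c', rfl, ⟨j, ⟨hi, rfl⟩, rfl⟩, hw⟩
      exact ⟨⟨i, hi⟩, w', hw, rfl⟩
    · rintro ⟨i, w', hw, rfl⟩
      exact ⟨i, w', _, rfl, ⟨_, ⟨i.2, rfl⟩, rfl⟩, hw⟩
  have hfin : ∀ i : Fin is.length, (List.cons i.1 '' M.acceptingFrom (F is[i])).Finite :=
    fun i => (h _ (List.getElem_mem _)).finite.image _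
  refine ⟨fun w hw => ?_, ?_, ?_⟩
  · cases w with
    | nil => simp
    | cons i w =>
      simp only [follow, hF, List.getElem?_map] at hw
      cases hi : is[i]? with
      | none => simp [hi] at hw
      | some j =>
        simp only [hi, Option.map_some, Option.bind_some] at hw
        simpa using (h j (List.mem_of_getElem? hi)).bound w hw
  · rw [key]
    exact Set.finite_iUnion hfin
  · rw [key, Set.ncard_iUnion_of_finite hfin, finsum_eq_sum_of_fintype, Nat.cast_sum]
    · rw [← Fin.sum_univ_fun_getElem]
      refine Finset.sum_congr rfl fun i _ => ?_
      rw [Set.ncard_image_of_injective _ List.cons_injective]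
      exact (h _ (List.getElem_mem _)).count
    · intro i j hij
      refine Set.disjoint_left.2 ?_
      rintro _ ⟨w, -, rfl⟩ ⟨w', -, hw⟩
      exact hij (Fin.ext (List.cons.inj hw).1.symm)

/-- A configuration with a unique successor has the count of this successor. -/
theorem Counts.det {l : M.Λ} {v : M.σ} {S : ∀ i, List (M.Γ i)} {q : TM2.Stmt M.Γ M.Λ M.σ}
    (hq : M.m l = [q]) {t : ℕ} {a : ZMod k}
    (h : M.Counts k (@TM2.stepAux M.K M.Γ M.Λ M.σ M.decK q v S) t a) :
    M.Counts k ⟨some l, v, S⟩ (t + 1) a := by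
  have := Counts.step (M := M) (l := l) (v := v) (S := S) [()]
    (fun _ => @TM2.stepAux M.K M.Γ M.Λ M.σ M.decK q v S) (by simp [NTM.step, hq])
    (g := fun _ => a) (t := t) (by simpa using h)
  simpa using this

end NTM

end

section

/-! ### The circuit and its contragredient on a pair of registers -/

variable {k : ℕ}

theorem gateMap_ket {h : ℕ} (M : Gate k h) (pos : Fin h → ℕ) (x : List Bool) :
    gateMap M pos (ket k x) = ∑ y : Fin h → Bool,
      (M : Matrix (Fin h → Bool) (Fin h → Bool) (ZMod k)) y (readBits pos x) •
        ket k (writeBits pos y x) := by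
  simp [gateMap, ket, Finsupp.linearCombination_single]

theorem appendBit_ket (b : Bool) (x : List Bool) : appendBit k b (ket k x) = ket k (x ++ [b]) := by
  simp [appendBit, ket]

theorem foldl_set_length {α ι : Type*} (js : List ι) (p : ι → ℕ) (y : ι → α) (x : List α) :
    (js.foldl (fun z j => z.set (p j) (y j)) x).length = x.length := by
  induction js generalizing x with
  | nil => rfl
  | cons j js ih => simp [ih]

theorem foldl_set_getElem?_of_notMem {α ι : Type*} (js : List ι) (p : ι → ℕ) (y : ι → α)
    (x : List α) (i : ℕ) (hi : ∀ j ∈ js, p j ≠ i) :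
    (js.foldl (fun z j => z.set (p j) (y j)) x)[i]? = x[i]? := by
  induction js generalizing x with
  | nil => rfl
  | cons j js ih =>
    rw [List.foldl_cons, ih _ fun j' hj' => hi j' (List.mem_cons_of_mem _ hj'),
      List.getElem?_set_ne (hi j List.mem_cons_self)]

theorem foldl_set_getElem?_of_mem {α ι : Type*} (js : List ι) (p : ι → ℕ) (y : ι → α)
    (hp : Function.Injective p) (x : List α) (i : ι) (hi : i ∈ js) (hx : p i < x.length) :
    (js.foldl (fun z j => z.set (p j) (y j)) x)[p i]? = some (y i) := by
  classical
  induction js generalizing x with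
  | nil => simp at hi
  | cons j js ih =>
    rw [List.foldl_cons]
    by_cases hj : i ∈ js
    · exact ih _ hj (by simpa using hx)
    · obtain rfl : i = j := by simpa [hj] using hi
      rw [foldl_set_getElem?_of_notMem]
      · simp [hx]
      · rintro j' hj' h
        exact hj (hp h ▸ hj')

theorem length_writeBits {h : ℕ} (pos : Fin h → ℕ) (y : Fin h → Bool) (x : List Bool) :
    (writeBits pos y x).length = x.length :=
  foldl_set_length _ _ _ _

theorem writeBits_getElem? {h : ℕ} {pos : Fin h → ℕ} (hpos : Function.Injective pos)
    (y : Fin h → Bool) (x : List Bool) (j : Fin h) (hj : pos j < x.length) :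
    (writeBits pos y x)[pos j]? = some (y j) :=
  foldl_set_getElem?_of_mem _ _ _ hpos _ _ (List.mem_finRange j) hj

theorem writeBits_getElem?_of_ne {h : ℕ} {pos : Fin h → ℕ}
    (y : Fin h → Bool) (x : List Bool) (i : ℕ) (hi : ∀ j, pos j ≠ i) :
    (writeBits pos y x)[i]? = x[i]? :=
  foldl_set_getElem?_of_notMem _ _ _ _ _ fun j _ => hi j

theorem readBits_eq_iff {h : ℕ} {pos : Fin h → ℕ} {x : List Bool} (hx : ∀ j, pos j < x.length)
    (a : Fin h → Bool) : readBits pos x = a ↔ ∀ j, x[pos j]? = some (a j) := by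
  rw [funext_iff]
  refine forall_congr' fun j => ?_
  simp [readBits, hx j]

/-- Overwriting the positions `pos` of two strings gives the same result iff the same bits are
written and the strings agree elsewhere. -/
theorem writeBits_eq_writeBits {h : ℕ} {pos : Fin h → ℕ} (hpos : Function.Injective pos)
    {u v : List Bool} (hl : u.length = v.length) (hu : ∀ j, pos j < u.length)
    (b b' : Fin h → Bool) :
    writeBits pos b u = writeBits pos b' v ↔
      b = b' ∧ ∀ i, (∀ j, pos j ≠ i) → u[i]? = v[i]? := by
  constructor
  · intro e
    refine ⟨funext fun j => ?_, fun i hi => ?_⟩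
    · have := congrArg (fun l => l[pos j]?) e
      simpa [writeBits_getElem? hpos _ _ j (hu j),
        writeBits_getElem? hpos _ _ j (hl ▸ hu j)] using this
    · have := congrArg (fun l => l[i]?) e
      simpa [writeBits_getElem?_of_ne _ _ i hi] using this
  · rintro ⟨rfl, e⟩
    refine List.ext_getElem? fun i => ?_
    by_cases hi : ∃ j, pos j = i
    · obtain ⟨j, rfl⟩ := hi
      rw [writeBits_getElem? hpos _ _ j (hu j), writeBits_getElem? hpos _ _ j (hl ▸ hu j)]
    · push Not at hi
      rw [writeBits_getElem?_of_ne _ _ i hi, writeBits_getElem?_of_ne _ _ i hi, e i hi]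

theorem eq_iff_readBits_eq {h : ℕ} {pos : Fin h → ℕ} {u v : List Bool}
    (hl : u.length = v.length) (hu : ∀ j, pos j < u.length) :
    u = v ↔ readBits pos u = readBits pos v ∧ ∀ i, (∀ j, pos j ≠ i) → u[i]? = v[i]? := by
  constructor
  · rintro rfl
    exact ⟨rfl, fun _ _ => rfl⟩
  · rintro ⟨hr, e⟩
    refine List.ext_getElem? fun i => ?_
    by_cases hi : ∃ j, pos j = i
    · obtain ⟨j, rfl⟩ := hi
      rw [readBits_eq_iff hu] at hr
      rw [hr j]
      exact ((readBits_eq_iff (fun j => hl ▸ hu j) _).1 rfl j).symm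
    · push Not at hi
      exact e i hi

/-- The sum over all pairs of computational paths of `C`, from `u` in the first register and from
`v` in the second one, that end in the same string `y`, weighted by `t y`. The first register
evolves by the gates of `C` and the second one by their inverse transposes. -/
def pairSum (t : List Bool → ZMod k) : Circuit k → List Bool → List Bool → ZMod k
  | [], u, v => if u = v then t u else 0
  | .prep :: C, u, v => pairSum t C (u ++ [false]) (v ++ [false])
  | .gate h M pos :: C, u, v =>
    ∑ b : Fin (h + 1) → Bool, ∑ b' : Fin (h + 1) → Bool,
      M.1 b (readBits pos u) * M⁻¹.1 (readBits pos v) b' *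
        pairSum t C (writeBits pos b u) (writeBits pos b' v)

/-- Unweighted, the second register is propagated by the contragredient of the first one, so the
standard pairing of the two is preserved. -/
theorem pairSum_one (C : Circuit k) (u v : List Bool) (hl : u.length = v.length)
    (hC : C.WellFormed u.length) : pairSum 1 C u v = if u = v then 1 else 0 := by
  classical
  induction C generalizing u v with
  | nil => rfl
  | cons o C ih =>
    cases o with
    | prep =>
      rw [Circuit.WellFormed] at hC
      rw [pairSum, ih _ _ (by simp [hl]) (by simpa using hC)]
      simp
    | gate h M pos =>
      obtain ⟨⟨hpos, hu⟩, hC⟩ := hC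
      have step : ∀ b b', pairSum 1 C (writeBits pos b u) (writeBits pos b' v) =
          if writeBits pos b u = writeBits pos b' v then 1 else 0 := fun b b' =>
        ih _ _ (by simp [length_writeBits, hl]) (by simpa [length_writeBits] using hC)
      have inv : ∑ b, M⁻¹.1 (readBits pos v) b * M.1 b (readBits pos u) =
          if readBits pos u = readBits pos v then 1 else 0 := by
        rw [← Matrix.mul_apply, ← Units.val_mul, inv_mul_cancel, Units.val_one, Matrix.one_apply]
        exact if_congr eq_comm rfl rfl
      rw [pairSum]
      simp only [step]
      -- Strings that differ off `pos` stay different, whatever is written.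
      by_cases hoff : ∀ i, (∀ j, pos j ≠ i) → u[i]? = v[i]?
      · have hw : ∀ b b', writeBits pos b u = writeBits pos b' v ↔ b = b' := fun b b' =>
          (writeBits_eq_writeBits hpos hl hu b b').trans (and_iff_left hoff)
        have huv : u = v ↔ readBits pos u = readBits pos v :=
          (eq_iff_readBits_eq hl hu).trans (and_iff_left hoff)
        simp only [hw, huv, ← inv]
        refine Finset.sum_congr rfl fun b _ => ?_
        rw [Finset.sum_eq_single b (fun b' _ hb => by rw [if_neg hb.symm, mul_zero])
          (fun hb => absurd (Finset.mem_univ b) hb), if_pos rfl, mul_one, mul_comm]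
      · have hw : ∀ b b', writeBits pos b u ≠ writeBits pos b' v := fun b b' e =>
          hoff ((writeBits_eq_writeBits hpos hl hu b b').1 e).2
        have huv : u ≠ v := by rintro rfl; exact hoff fun _ _ => rfl
        rw [if_neg huv]
        refine Finset.sum_eq_zero fun b _ => Finset.sum_eq_zero fun b' _ => ?_
        rw [if_neg (hw b b'), mul_zero]

/-- The amplitude with which the second register reaches `y` from `v`. -/
def dualAmplitude : Circuit k → List Bool → List Bool → ZMod k
  | [], y, v => if y = v then 1 else 0
  | .prep :: C, y, v => dualAmplitude C y (v ++ [false])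
  | .gate h M pos :: C, y, v =>
    ∑ b' : Fin (h + 1) → Bool, M⁻¹.1 (readBits pos v) b' * dualAmplitude C y (writeBits pos b' v)

theorem pairSum_eq_linearCombination (t : List Bool → ZMod k) (C : Circuit k)
    (u v : List Bool) : pairSum t C u v =
      Finsupp.linearCombination (ZMod k) (fun y => t y * dualAmplitude C y v)
        (Circuit.toLin C (ket k u)) := by
  induction C generalizing u v with
  | nil => simp [pairSum, Circuit.toLin, dualAmplitude, ket, Finsupp.linearCombination_single]
  | cons o C ih =>
    cases o with
    | prep => simp [pairSum, Circuit.toLin, dualAmplitude, Op.toLin, appendBit_ket, ih]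
    | gate h M pos =>
      simp only [pairSum, Circuit.toLin, dualAmplitude, Op.toLin, gateMap_ket, ih, map_sum,
        LinearMap.comp_apply, map_smul]
      refine Finset.sum_congr rfl fun b _ => ?_
      simp only [Finsupp.linearCombination_apply, Finsupp.sum, Finset.mul_sum, smul_eq_mul]
      rw [Finset.sum_comm]
      refine Finset.sum_congr rfl fun y _ => Finset.sum_congr rfl fun b' _ => by ring

/-- If `C|x⟩ = ψ ⊗ |b⟩`, then the pairs of paths that meet in a string with last bit `1` contribute
`⟨x|x⟩ = 1` if `b = 1`, and nothing if `b = 0`. -/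
theorem pairSum_of_toLin_eq {C : Circuit k} {x : List Bool} (hC : C.WellFormed x.length)
    {b : Bool} {ψ : Dist k} (hψ : Circuit.toLin C (ket k x) = appendBit k b ψ) :
    pairSum (fun y => if y.getLast? = some true then 1 else 0) C x x = if b then 1 else 0 := by
  have h1 := pairSum_one C x x rfl hC
  rw [pairSum_eq_linearCombination, hψ, appendBit, Finsupp.lmapDomain_apply,
    Finsupp.linearCombination_mapDomain] at h1 ⊢
  cases b with
  | true => simpa [Function.comp_def] using h1
  | false => simp [Function.comp_def, Finsupp.linearCombination_apply]

end

section

/-! ### The simulating machine -/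

/-- A cell of the simulation: the current bit of the first and of the second register. -/
abbrev Cell : Type := Bool × Bool

/-- The auxiliary stacks: the input, the cells of the two registers on either side of a cursor
(`left` is the part before the cursor, its last cell on top), and the pending cell rewrites of the
gate being performed, each as a pair of expected and new contents. -/
inductive Aux : Type
  | inp | left | right | todo
  deriving DecidableEq

instance : Finite Aux := by
  refine Finite.of_surjective (fun i : Fin 4 => ![Aux.inp, .left, .right, .todo] i) fun a => ?_
  cases a
  exacts [⟨0, rfl⟩, ⟨1, rfl⟩, ⟨2, rfl⟩, ⟨3, rfl⟩]

/-- The alphabets of the auxiliary stacks. -/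
abbrev Aux.Γ : Aux → Type
  | .inp => Bool
  | .left => Cell
  | .right => Cell
  | .todo => Cell × Cell

instance (i : Aux) : Finite i.Γ := by
  cases i <;> exact inferInstanceAs (Finite (_ : Type))

variable {k : ℕ} (T : FinTM2)

/-- The alphabets of the stacks: those of `T` and the auxiliary ones. -/
abbrev SimΓ : T.K ⊕ Aux → Type
  | .inl i => T.Γ i
  | .inr i => i.Γ

variable (k) in
/-- The labels of the simulating machine. -/
inductive SimLabel : Type
  | start
  | copy
  | run (l : T.Λ)
  | main
  | advance
  | rewrite
  | prep
  | guess (g : Σ h : Fin 4, Gate k (h + 1))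
  | rewind
  | final

variable (k) in
/-- The internal states of the simulating machine: the state of `T`, buffers for the symbols
most recently read, and whether to accept when halting. -/
structure SimState : Type where
  base : T.σ
  inp : Option Bool
  sym : Option (Sym k)
  cell : Option Cell
  todo : Option (Cell × Cell)
  acc : Bool

instance [NeZero k] : Finite (SimLabel k T) := by
  have := T.ΛFin
  refine Finite.of_surjective
    (α := Fin 8 ⊕ T.Λ ⊕ (Σ h : Fin 4, Gate k (h + 1)))
    (fun | .inl i => ![.start, .copy, .main, .prep, .rewind, .final, .advance, .rewrite] i
         | .inr (.inl l) => .run l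
         | .inr (.inr g) => .guess g) fun a => ?_
  cases a with
  | start => exact ⟨.inl 0, rfl⟩
  | copy => exact ⟨.inl 1, rfl⟩
  | main => exact ⟨.inl 2, rfl⟩
  | prep => exact ⟨.inl 3, rfl⟩
  | rewind => exact ⟨.inl 4, rfl⟩
  | final => exact ⟨.inl 5, rfl⟩
  | advance => exact ⟨.inl 6, rfl⟩
  | rewrite => exact ⟨.inl 7, rfl⟩
  | run l => exact ⟨.inr (.inl l), rfl⟩
  | guess g => exact ⟨.inr (.inr g), rfl⟩

theorem SimState.finite [Finite (Sym k)] : Finite (SimState k T) := by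
  have := T.σFin
  refine Finite.of_injective (fun s : SimState k T =>
    (s.base, s.inp, s.sym, s.cell, s.todo, s.acc)) ?_
  rintro ⟨⟩ ⟨⟩ h
  simpa using h

/-- The statements of the simulating machine. -/
abbrev SimStmt (k : ℕ) (T : FinTM2) : Type := TM2.Stmt (SimΓ T) (SimLabel k T) (SimState k T)

/-- A statement of `T` as a statement of the simulating machine. Instead of halting, the latter
goes on to simulate the circuit that `T` has written. -/
def liftStmt : TM2.Stmt T.Γ T.Λ T.σ → SimStmt k T
  | .push i f q => .push (.inl i) (fun s => f s.base) (liftStmt q)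
  | .peek i f q => .peek (.inl i) (fun s a => { s with base := f s.base a }) (liftStmt q)
  | .pop i f q => .pop (.inl i) (fun s a => { s with base := f s.base a }) (liftStmt q)
  | .load f q => .load (fun s => { s with base := f s.base }) (liftStmt q)
  | .branch f q₁ q₂ => .branch (fun s => f s.base) (liftStmt q₁) (liftStmt q₂)
  | .goto f => .goto fun s => .run (f s.base)
  | .halt => .goto fun _ => .rewind

/-- A guess for the effect of a gate on `h` bits on the two registers: old and new contents of
the first one, old and new contents of the second one. -/
abbrev Guess (h : ℕ) : Type :=
  ((Fin h → Bool) × (Fin h → Bool)) × ((Fin h → Bool) × (Fin h → Bool))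

/-- The cell rewrite at the `j`-th position of a gate. -/
def Guess.todo {h : ℕ} (p : Guess h) (j : Fin h) : Cell × Cell :=
  ((p.1.1 j, p.2.1 j), (p.1.2 j, p.2.2 j))

/-- The weight of a guess: the matrix element of the gate in the first register times the one
of the inverse transpose in the second register. -/
def Guess.weight {h : ℕ} (M : Gate k h) (p : Guess h) : ZMod k :=
  M.1 p.1.2 p.1.1 * M⁻¹.1 p.2.1 p.2.2

/-- Each guess, with multiplicity its weight. -/
noncomputable def guesses {h : ℕ} (M : Gate k h) : List (Guess h) :=
  Finset.univ.toList.flatMap fun p => List.replicate (p.weight M).val p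

/-- Push a list of cell rewrites, such that the first one ends up on top. -/
def pushTodo (q : SimStmt k T) : List (Cell × Cell) → SimStmt k T
  | [] => q
  | e :: es => pushTodo (.push (.inr .todo) (fun _ => e) q) es

variable {T} in
/-- The label at which a symbol of the description of the circuit is processed. At the end of the
description, the registers are tested. -/
def SimLabel.ofSym : Option (Sym k) → SimLabel k T
  | none => .final
  | some .prep => .prep
  | some (.gate h M) => .guess ⟨h, M⟩
  | some .one => .advance
  | some .sep => .rewrite

variable {T} (ei : T.Γ T.k₀ ≃ Bool) (eo : T.Γ T.k₁ ≃ Sym k) (acceptNil : Bool)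

/-- The transitions of the simulating machine. -/
noncomputable def simStmts : SimLabel k T → List (SimStmt k T)
  | .start =>
    [.peek (.inr .inp) (fun s a => { s with inp := a }) <|
      .branch (fun s => s.inp.isSome) (.goto fun _ => .copy) <|
      .load (fun s => { s with acc := acceptNil }) .halt]
  | .copy =>
    [.pop (.inr .inp) (fun s a => { s with inp := a }) <|
      .branch (fun s => s.inp.isSome)
        (.push (.inr .left) (fun s => (s.inp.getD false, s.inp.getD false)) <|
          .push (.inl T.k₀) (fun _ => ei.symm true) <| .goto fun _ => .copy) <|
      .goto fun _ => .run T.main]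
  | .run l => [liftStmt T (T.m l)]
  | .main =>
    [.pop (.inl T.k₁) (fun s a => { s with sym := a.map eo }) <|
      .goto fun s => .ofSym s.sym]
  | .advance =>
    [.pop (.inr .right) (fun s a => { s with cell := a }) <|
      .push (.inr .left) (fun s => s.cell.getD default) <| .goto fun _ => .main]
  | .rewrite =>
    [.pop (.inr .right) (fun s a => { s with cell := a }) <|
      .pop (.inr .todo) (fun s a => { s with todo := a }) <|
      .branch (fun s => s.cell == s.todo.map Prod.fst)
        (.push (.inr .right) (fun s => (s.todo.getD default).2) <| .goto fun _ => .rewind)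
        .halt]
  | .prep =>
    [.pop (.inr .right) (fun s a => { s with cell := a }) <|
      .branch (fun s => s.cell.isSome)
        (.push (.inr .left) (fun s => s.cell.getD default) <| .goto fun _ => .prep) <|
      .push (.inr .right) (fun _ => (false, false)) <| .goto fun _ => .rewind]
  | .guess g =>
    (guesses g.2).map fun p =>
      pushTodo T (.goto fun _ => .main) ((List.finRange (g.1 + 1)).map p.todo)
  | .rewind =>
    [.pop (.inr .left) (fun s a => { s with cell := a }) <|
      .branch (fun s => s.cell.isSome)
        (.push (.inr .right) (fun s => s.cell.getD default) <| .goto fun _ => .rewind) <|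
      .goto fun _ => .main]
  | .final =>
    [.pop (.inr .right) (fun s a => { s with cell := a }) <|
      .branch (fun s => s.cell.isSome)
        (.branch (fun s => (s.cell.getD default).1 == (s.cell.getD default).2)
          (.load (fun s => { s with acc := (s.cell.getD default).1 }) <| .goto fun _ => .final) <|
          .load (fun s => { s with acc := false }) .halt)
        .halt]

/-- The machine that computes the description of a circuit by running `T` on `1ⁿ` and then
simulates the circuit on two registers. -/
noncomputable def simulator [NeZero k] [∀ i, Finite (T.Γ i)] : NTM where
  K := T.K ⊕ Aux
  decK := inferInstance
  finK := have := T.kFin; inferInstance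
  k₀ := .inr .inp
  Γ := SimΓ T
  finΓ := by
    rintro (i | i)
    · exact inferInstanceAs (Finite (T.Γ i))
    · exact inferInstanceAs (Finite i.Γ)
  inputAlphabet := Equiv.refl Bool
  Λ := SimLabel k T
  main := .start
  σ := SimState k T
  finσ := by
    have : Finite (Sym k) := .of_equiv _ eo
    exact SimState.finite T
  initialState := ⟨T.initialState, none, none, none, none, false⟩
  m := simStmts ei eo acceptNil
  accept := {s | s.acc = true}

/-! ### Configurations and elementary loops of the simulating machine -/

/-- The contents of the stacks of the simulating machine. -/
def simStk (S : ∀ i, List (T.Γ i)) (I : List Bool) (A B : List Cell) (Q : List (Cell × Cell)) :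
    ∀ i, List (SimΓ T i)
  | .inl i => S i
  | .inr .inp => I
  | .inr .left => A
  | .inr .right => B
  | .inr .todo => Q

section

variable (S : ∀ i, List (T.Γ i)) (I : List Bool) (A B : List Cell) (Q : List (Cell × Cell))

@[simp] theorem simStk_inl (i : T.K) : simStk S I A B Q (.inl i) = S i := rfl
@[simp] theorem simStk_inp : simStk S I A B Q (.inr .inp) = I := rfl
@[simp] theorem simStk_left : simStk S I A B Q (.inr .left) = A := rfl
@[simp] theorem simStk_right : simStk S I A B Q (.inr .right) = B := rfl
@[simp] theorem simStk_todo : simStk S I A B Q (.inr .todo) = Q := rfl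

@[simp] theorem update_simStk_inl (i : T.K) (l : List (T.Γ i)) :
    Function.update (simStk S I A B Q) (.inl i) l = simStk (Function.update S i l) I A B Q := by
  funext j
  rcases j with j | j
  · by_cases h : j = i
    · subst h; simp
    · rw [Function.update_of_ne (by simpa using h)]; simp [h]
  · cases j <;> rfl

@[simp] theorem update_simStk_inp (l : List Bool) :
    Function.update (simStk S I A B Q) (.inr .inp) l = simStk S l A B Q := by
  funext j; rcases j with j | (_ | _ | _ | _) <;> rfl

@[simp] theorem update_simStk_left (l : List Cell) :
    Function.update (simStk S I A B Q) (.inr .left) l = simStk S I l B Q := by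
  funext j; rcases j with j | (_ | _ | _ | _) <;> rfl

@[simp] theorem update_simStk_right (l : List Cell) :
    Function.update (simStk S I A B Q) (.inr .right) l = simStk S I A l Q := by
  funext j; rcases j with j | (_ | _ | _ | _) <;> rfl

@[simp] theorem update_simStk_todo (l : List (Cell × Cell)) :
    Function.update (simStk S I A B Q) (.inr .todo) l = simStk S I A B l := by
  funext j; rcases j with j | (_ | _ | _ | _) <;> rfl

theorem stepAux_pushTodo (q : SimStmt k T) (es : List (Cell × Cell)) (s : SimState k T) :
    TM2.stepAux (pushTodo T q es) s (simStk S I A B Q) =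
      TM2.stepAux q s (simStk S I A B (es ++ Q)) := by
  induction es generalizing q with
  | nil => rfl
  | cons e es ih => simp [pushTodo, ih]

end

variable [NeZero k] [∀ i, Finite (T.Γ i)]

variable {ei eo acceptNil}

variable (ei eo acceptNil) in
/-- From the configuration `c`, the simulating machine makes at most `t` steps, and the number of
accepting branches is `a` modulo `k`. -/
def SimCounts (c : TM2.Cfg (SimΓ T) (SimLabel k T) (SimState k T)) (t : ℕ) (a : ZMod k) : Prop :=
  (simulator ei eo acceptNil).Counts k c t a

theorem SimCounts.mono {c : TM2.Cfg (SimΓ T) (SimLabel k T) (SimState k T)} {t t' : ℕ} {a : ZMod k}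
    (h : SimCounts ei eo acceptNil c t a) (ht : t ≤ t') : SimCounts ei eo acceptNil c t' a :=
  NTM.Counts.mono h ht

/-- `NTM.Counts.step` for the simulating machine, in terms of statements. -/
theorem SimCounts.step {ι : Type*} {l : SimLabel k T} {s : SimState k T}
    {S : ∀ i, List (SimΓ T i)} (is : List ι) (q : ι → SimStmt k T)
    (hq : simStmts ei eo acceptNil l = is.map q) {t : ℕ} {g : ι → ZMod k}
    (h : ∀ i ∈ is, SimCounts ei eo acceptNil (TM2.stepAux (q i) s S) t (g i)) :
    SimCounts ei eo acceptNil ⟨some l, s, S⟩ (t + 1) (is.map g).sum :=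
  NTM.Counts.step (M := simulator ei eo acceptNil) is
    (fun i => (TM2.stepAux (q i) s S : TM2.Cfg (SimΓ T) (SimLabel k T) (SimState k T)))
    ((congrArg (List.map _) hq).trans (List.map_map ..)) h

theorem SimCounts.det {l : SimLabel k T} {s : SimState k T} {S : ∀ i, List (SimΓ T i)}
    {q : SimStmt k T} (hq : simStmts ei eo acceptNil l = [q]) {t : ℕ} {a : ZMod k}
    (h : SimCounts ei eo acceptNil (TM2.stepAux q s S) t a) :
    SimCounts ei eo acceptNil ⟨some l, s, S⟩ (t + 1) a :=
  NTM.Counts.det hq h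

theorem SimCounts.halt {s : SimState k T} {b : Bool} (hb : s.acc = b)
    (S : ∀ i, List (SimΓ T i)) (t : ℕ) :
    SimCounts ei eo acceptNil ⟨none, s, S⟩ t (if b = true then 1 else 0) := by
  split_ifs with h
  · exact NTM.Counts.halted_accept (M := simulator ei eo acceptNil) t (hb.trans h)
  · exact NTM.Counts.halted_reject (M := simulator ei eo acceptNil) t (fun h' => h (hb ▸ h'))

/-- The cursor goes back to the first cell. -/
theorem counts_rewind {S : ∀ i, List (T.Γ i)} {I : List Bool} {Q : List (Cell × Cell)}
    {t : ℕ} {a : ZMod k} (A B : List Cell) (s : SimState k T) (hs : s.acc = false)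
    (h : ∀ s : SimState k T, s.acc = false → SimCounts ei eo acceptNil
      ⟨some .main, s, simStk S I [] (A.reverse ++ B) Q⟩ t a) :
    SimCounts ei eo acceptNil ⟨some .rewind, s, simStk S I A B Q⟩
      (t + A.length + 1) a := by
  induction A generalizing B s with
  | nil =>
    refine SimCounts.det rfl ?_
    simpa using h { s with cell := none } hs
  | cons c A ih =>
    refine SimCounts.det rfl ?_
    simpa [Nat.add_assoc] using ih (c :: B) { s with cell := some c } hs (by simpa using h)

/-- A bit is adjoined to each of the two registers. -/
theorem counts_prep {S : ∀ i, List (T.Γ i)} {I : List Bool} {Q : List (Cell × Cell)}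
    {t : ℕ} {a : ZMod k} (A B : List Cell) (s : SimState k T) (hs : s.acc = false)
    (h : ∀ s : SimState k T, s.acc = false → SimCounts ei eo acceptNil
      ⟨some .main, s, simStk S I [] (A.reverse ++ B ++ [(false, false)]) Q⟩ t a) :
    SimCounts ei eo acceptNil ⟨some .prep, s, simStk S I A B Q⟩
      (t + A.length + 2 * B.length + 2) a := by
  induction B generalizing A s with
  | nil =>
    refine SimCounts.det rfl ?_
    simpa using counts_rewind A [(false, false)] { s with cell := none } hs (by simpa using h)
  | cons c B ih =>
    refine SimCounts.det rfl ?_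
    have := ih (c :: A) { s with cell := some c } hs (by simpa using h)
    simp only [List.length_cons] at this ⊢
    simpa using this.mono (t' := t + A.length + 2 * (B.length + 1) + 1) (by omega)

/-- The final test that the two registers agree and that their last bit is `1`. -/
theorem counts_final {S : ∀ i, List (T.Γ i)} {I : List Bool} {A : List Cell}
    {Q : List (Cell × Cell)} (u v : List Bool) (hl : u.length = v.length) (s : SimState k T) :
    SimCounts ei eo acceptNil ⟨some .final, s, simStk S I A (u.zip v) Q⟩
      (u.length + 1) (if u = v then if u.getLast?.getD s.acc = true then 1 else 0 else 0) := by
  induction u generalizing v s with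
  | nil =>
    obtain rfl : v = [] := by simpa using hl.symm
    refine SimCounts.det rfl ?_
    convert SimCounts.halt (s := { s with cell := none }) rfl (simStk S I A [] Q) _ using 1
    · simp
    · exact if_pos rfl
  | cons a u ih =>
    obtain _ | ⟨b, v⟩ := v
    · simp at hl
    refine SimCounts.det rfl ?_
    by_cases hab : a = b
    · subst hab
      have := ih v (by simpa using hl) { s with cell := some (a, a), acc := a }
      simpa [List.getLast?_cons] using this
    · have hab' : (a == b) = false := by simpa using hab
      simpa [hab, hab'] using
        SimCounts.halt (s := { s with cell := some (a, b), acc := false }) rfl _ _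

end

section

/-! ### Correctness of the circuit simulation -/

variable {k : ℕ} {T : FinTM2} {ei : T.Γ T.k₀ ≃ Bool} {eo : T.Γ T.k₁ ≃ Sym k} {acceptNil : Bool}
  [NeZero k] [∀ i, Finite (T.Γ i)]

variable (eo) in
/-- The stacks of `T` when its output stack contains `out` and all others are empty. -/
def outStk (out : List (Sym k)) : ∀ i, List (T.Γ i) :=
  Function.update (fun _ => []) T.k₁ (out.map eo.symm)

/-- The next symbol of the description of the circuit is read. -/
theorem counts_main {I : List Bool} {A B : List Cell} {Q : List (Cell × Cell)}
    {out : List (Sym k)} {t : ℕ} {a : ZMod k} (y : Sym k) (s : SimState k T)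
    (h : SimCounts ei eo acceptNil
      ⟨some (.ofSym (some y)), { s with sym := some y }, simStk (outStk eo out) I A B Q⟩ t a) :
    SimCounts ei eo acceptNil
      ⟨some .main, s, simStk (outStk eo (y :: out)) I A B Q⟩ (t + 1) a := by
  refine SimCounts.det rfl ?_
  simpa [outStk] using h

/-- The cursor moves by `p` cells. -/
theorem counts_ones {I : List Bool} {Q : List (Cell × Cell)} {out : List (Sym k)}
    {t : ℕ} {a : ZMod k} (p : ℕ) (A B : List Cell) (hp : p ≤ B.length)
    (s : SimState k T) (hs : s.acc = false)
    (h : ∀ s : SimState k T, s.acc = false → SimCounts ei eo acceptNil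
      ⟨some .main, s, simStk (outStk eo out) I ((B.take p).reverse ++ A) (B.drop p) Q⟩ t a) :
    SimCounts ei eo acceptNil
      ⟨some .main, s, simStk (outStk eo (List.replicate p .one ++ out)) I A B Q⟩ (t + 2 * p) a := by
  induction p generalizing A B s with
  | zero => simpa using h s hs
  | succ p ih =>
    obtain _ | ⟨c, B⟩ := B
    · simp at hp
    rw [List.replicate_succ, List.cons_append]
    refine counts_main (t := t + 2 * p + 1) .one s (SimCounts.det rfl ?_)
    simpa using ih (c :: A) B (by simpa using hp) { s with sym := some .one, cell := some c } hs
      (by simpa using h)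

/-- The pending cell rewrites are performed one after the other, provided that each cell has the
expected contents. -/
theorem counts_rewrites {ι : Type*} {I : List Bool} {out : List (Sym k)} {t : ℕ} {a : ZMod k}
    {pos : ι → ℕ} (hpos : Function.Injective pos) (e : ι → Cell × Cell)
    (js : List ι) (hjs : js.Nodup) (z : List Cell) (hz : ∀ j ∈ js, pos j < z.length)
    (s : SimState k T) (hs : s.acc = false)
    (h : ∀ s : SimState k T, s.acc = false → SimCounts ei eo acceptNil
      ⟨some .main, s, simStk (outStk eo out) I []
        (js.foldl (fun z j => z.set (pos j) (e j).2) z) []⟩ t a) :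
    SimCounts ei eo acceptNil
      ⟨some .main, s, simStk (outStk eo (js.flatMap (fun j => List.replicate (pos j) .one ++ [.sep])
        ++ out)) I [] z (js.map e)⟩
      (t + (js.flatMap (fun j => List.replicate (pos j) (Sym.one (k := k)) ++ [.sep])).length *
        (z.length + 3))
      (if ∀ j ∈ js, z[pos j]? = some (e j).1 then a else 0) := by
  induction js generalizing z s with
  | nil => simpa using h s hs
  | cons j js ih =>
    have hj : pos j < z.length := hz j List.mem_cons_self
    obtain ⟨hjs', hjs⟩ := List.nodup_cons.1 hjs
    -- The positions are distinct, so the later cells still have their original contents.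
    have hne : ∀ j' ∈ js, (z.set (pos j) (e j).2)[pos j']? = z[pos j']? := fun j' hj' =>
      List.getElem?_set_ne fun hp => hjs' (by rwa [hpos hp])
    have ih := ih hjs (z.set (pos j) (e j).2)
      (fun j' hj' => by simpa using hz j' (List.mem_cons_of_mem _ hj'))
    set w := (js.flatMap (fun j => List.replicate (pos j) (Sym.one (k := k)) ++ [.sep])) with hw
    simp only [List.flatMap_cons, List.map_cons, List.append_assoc, List.length_append,
      List.length_replicate, List.length_singleton, ← hw]
    refine SimCounts.mono (counts_ones (t := t + w.length * (z.length + 3) + pos j + 3) (pos j) [] z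
      hj.le s hs fun s hs => ?_) ?_
    swap
    · have : 3 * pos j + 3 ≤ (pos j + 1) * (z.length + 3) := by nlinarith
      nlinarith
    rw [List.drop_eq_getElem_cons hj]
    rw [List.cons_append, List.nil_append]
    refine counts_main .sep s (SimCounts.det (t := t + w.length * (z.length + 3) + pos j + 1) rfl ?_)
    by_cases hc : z[pos j] = (e j).1
    · have := counts_rewind (ei := ei) (eo := eo) (acceptNil := acceptNil)
        (S := outStk eo (w ++ out)) (I := I) (Q := js.map e)
        (t := t + w.length * (z.length + 3))
        (a := if ∀ i ∈ j :: js, z[pos i]? = some (e i).1 then a else 0)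
        (z.take (pos j)).reverse ((e j).2 :: z.drop (pos j + 1))
        { s with sym := some .sep, cell := some z[pos j], todo := some (e j) } hs ?_
      · have hm : min (pos j) z.length = pos j := min_eq_left hj.le
        simpa [hc, hm, hj] using this
      · intro s hs
        have := ih s hs h
        rw [List.reverse_reverse, ← List.set_eq_take_append_cons_drop.trans (if_pos hj)]
        convert this using 2
        · simp
        · simp only [List.forall_mem_cons, List.getElem?_eq_getElem hj, hc, true_and]
          exact forall₂_congr fun j' hj' => by rw [hne j' hj']
    · have := SimCounts.halt (ei := ei) (eo := eo) (acceptNil := acceptNil)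
        (s := { s with sym := some .sep, cell := some z[pos j], todo := some (e j) }) hs
        (simStk (outStk eo (w ++ out)) I (z.take (pos j)).reverse (z.drop (pos j + 1))
          (js.map e)) (t + w.length * (z.length + 3) + pos j + 1)
      have hc' : (z[pos j] == (e j).1) = false := by simpa using hc
      simpa [hc, hc', hj] using this

theorem sum_map_guesses {h : ℕ} (M : Gate k h) (f : Guess h → ZMod k) :
    ((guesses M).map f).sum = ∑ p, p.weight M * f p := by
  have key : ∀ l : List (Guess h),
      ((l.flatMap fun p => List.replicate (p.weight M).val p).map f).sum =
        (l.map fun p => p.weight M * f p).sum := by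
    intro l
    induction l with
    | nil => rfl
    | cons p l ih => simp [ih]
  rw [guesses, key, Finset.sum_map_toList]

/-- A guess passes the tests of the cells iff its old bits are the current bits of the registers. -/
theorem zip_getElem?_eq_todo_iff {h : ℕ} {pos : Fin h → ℕ} {u v : List Bool}
    (hl : u.length = v.length) (hu : ∀ j, pos j < u.length) (p : Guess h) :
    (∀ j ∈ List.finRange h, (u.zip v)[pos j]? = some (p.todo j).1) ↔
      p.1.1 = readBits pos u ∧ p.2.1 = readBits pos v := by
  rw [eq_comm, readBits_eq_iff hu, @eq_comm _ p.2.1, readBits_eq_iff fun j => hl ▸ hu j]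
  simp [List.getElem?_zip_eq_some, Guess.todo, forall_and]

theorem foldl_set_zip {ι : Type*} (js : List ι) (pos : ι → ℕ) (b b' : ι → Bool)
    (u v : List Bool) :
    js.foldl (fun z j => z.set (pos j) (b j, b' j)) (u.zip v) =
      (js.foldl (fun z j => z.set (pos j) (b j)) u).zip
        (js.foldl (fun z j => z.set (pos j) (b' j)) v) := by
  induction js generalizing u v with
  | nil => rfl
  | cons j js ih =>
    simp only [List.foldl_cons]
    rw [← ih]
    congr 1
    refine List.ext_getElem (by simp) fun i h1 h2 => ?_
    simp only [List.getElem_set, List.getElem_zip]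
    split_ifs <;> rfl

theorem zip_writeBits {h : ℕ} (pos : Fin h → ℕ) (p : Guess h) (u v : List Bool) :
    (List.finRange h).foldl (fun z j => z.set (pos j) (p.todo j).2) (u.zip v) =
      (writeBits pos p.1.2 u).zip (writeBits pos p.2.2 v) :=
  foldl_set_zip _ _ _ _ _ _

omit [NeZero k] in
/-- Only the guesses that agree with the current bits contribute. -/
theorem sum_guess {h : ℕ} (M : Gate k h) (x y : Fin h → Bool)
    (f : (Fin h → Bool) → (Fin h → Bool) → ZMod k) :
    ∑ p : Guess h, p.weight M * (if p.1.1 = x ∧ p.2.1 = y then f p.1.2 p.2.2 else 0) =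
      ∑ b, ∑ b', M.1 b x * M⁻¹.1 y b' * f b b' := by
  simp only [Fintype.sum_prod_type, Guess.weight]
  rw [Finset.sum_eq_single x (fun a _ ha => by simp [ha])
    (fun hx => absurd (Finset.mem_univ x) hx)]
  refine Finset.sum_congr rfl fun b _ => ?_
  rw [Finset.sum_eq_single y (fun a _ ha => by simp [ha])
    (fun hx => absurd (Finset.mem_univ y) hx)]
  simp

/-- The simulation of a circuit `C` counts the pairs of paths of `C` that meet in a string with
last bit `1`. Since each preparation is a symbol of the description, `D` bounds the length of the
registers throughout, and the processing of a symbol takes at most `2 * D + 5` steps. -/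
theorem counts_circuit {I : List Bool} (C : Circuit k) (u v : List Bool) (hl : u.length = v.length)
    (hC : C.WellFormed u.length) (D : ℕ) (hD : u.length + (Circuit.encode C).length ≤ D)
    (s : SimState k T) (hs : s.acc = false) :
    SimCounts ei eo acceptNil
      ⟨some .main, s, simStk (outStk eo (Circuit.encode C)) I [] (u.zip v) []⟩
      ((Circuit.encode C).length * (2 * D + 5) + D + 2)
      (pairSum (fun y => if y.getLast? = some true then 1 else 0) C u v) := by
  induction C generalizing u v s with
  | nil =>
    have := counts_final (ei := ei) (eo := eo) (acceptNil := acceptNil) (S := outStk eo [])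
      (I := I) (A := []) (Q := []) u v hl { s with sym := none }
    refine SimCounts.mono (SimCounts.det (t := u.length + 1) rfl ?_) ?_
    · convert this using 1
      · simp [outStk, Circuit.encode, SimLabel.ofSym]
      · rw [pairSum]
        cases h : u.getLast? <;> simp [hs]
    · simp [Circuit.encode] at hD ⊢
      omega
  | cons o C ih =>
    have henc : Circuit.encode (o :: C) = o.encode ++ (Circuit.encode C) := rfl
    rw [henc, List.length_append] at hD ⊢
    cases o with
    | prep =>
      rw [Circuit.WellFormed] at hC
      simp only [Op.encode, List.length_singleton, List.singleton_append] at hD ⊢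
      refine SimCounts.mono (counts_main
        (t := (Circuit.encode C).length * (2 * D + 5) + D + 2 + 2 * u.length + 2) .prep s ?_) ?_
      · have := counts_prep (ei := ei) (eo := eo) (acceptNil := acceptNil)
          (S := outStk eo (Circuit.encode C)) (I := I) (Q := [])
          (t := (Circuit.encode C).length * (2 * D + 5) + D + 2)
          (a := pairSum (fun y => if y.getLast? = some true then 1 else 0) C (u ++ [false])
            (v ++ [false])) [] (u.zip v) { s with sym := some .prep } hs
          fun s hs => by
            have := ih (u ++ [false]) (v ++ [false]) (by simp [hl]) (by simpa using hC)
              (by simp; omega) s hs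
            rw [List.zip_append hl] at this
            simpa using this
        simpa [pairSum, hl, SimLabel.ofSym] using this
      · nlinarith
    | gate h M pos =>
      obtain ⟨⟨hpos, hu⟩, hC⟩ := hC
      simp only [Op.encode, List.cons_append, List.length_cons] at hD ⊢
      set w := (List.finRange (h + 1)).flatMap
        (fun j => List.replicate (pos j) (Sym.one (k := k)) ++ [.sep]) with hw
      have key : ∀ (s : SimState k T), s.acc = false → ∀ p : Guess (h + 1),
          SimCounts ei eo acceptNil
          (TM2.stepAux (pushTodo T (.goto fun _ => .main) ((List.finRange (h + 1)).map p.todo)) s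
            (simStk (outStk eo (w ++ (Circuit.encode C))) I [] (u.zip v) []))
          ((Circuit.encode C).length * (2 * D + 5) + D + 2 + w.length * (u.length + 3))
          (if p.1.1 = readBits pos u ∧ p.2.1 = readBits pos v then
            pairSum (fun y => if y.getLast? = some true then 1 else 0) C (writeBits pos p.1.2 u)
              (writeBits pos p.2.2 v) else 0) := by
        intro s hs p
        rw [stepAux_pushTodo]
        have := counts_rewrites (ei := ei) (eo := eo) (acceptNil := acceptNil) (I := I)
          (out := (Circuit.encode C)) (t := (Circuit.encode C).length * (2 * D + 5) + D + 2)
          (a := pairSum (fun y => if y.getLast? = some true then 1 else 0) C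
            (writeBits pos p.1.2 u) (writeBits pos p.2.2 v))
          hpos p.todo (List.finRange (h + 1)) (List.nodup_finRange _) (u.zip v)
          (fun j _ => by simpa [← hl] using hu j) s hs
          (fun s hs => by
            rw [zip_writeBits]
            exact ih _ _ (by simp [length_writeBits, hl]) (by simpa [length_writeBits] using hC)
              (by simp [length_writeBits]; omega) s hs)
        simp only [zip_getElem?_eq_todo_iff hl hu, ← hw] at this
        simpa only [TM2.stepAux, List.append_nil, List.length_zip, ← hl, min_self] using this
      refine SimCounts.mono (counts_main
        (t := (Circuit.encode C).length * (2 * D + 5) + D + 2 + w.length * (u.length + 3) + 1)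
        (.gate h M) s ?_) ?_
      · have := SimCounts.step (l := .guess ⟨h, M⟩) (guesses M) _ rfl
          (fun p _ => key { s with sym := some (.gate h M) } hs p)
        rw [sum_map_guesses, sum_guess M _ _ fun b b' =>
          pairSum (fun y => if y.getLast? = some true then 1 else 0) C (writeBits pos b u)
            (writeBits pos b' v)] at this
        exact this
      · nlinarith [Nat.mul_le_mul_left w.length (show u.length ≤ D by omega)]

end

section

/-! ### Simulating the machine that computes the circuit -/

/-- The number of push instructions in a statement. -/
def pushCount {K Λ σ : Type*} {Γ : K → Type*} : TM2.Stmt Γ Λ σ → ℕ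
  | .push _ _ q => pushCount q + 1
  | .peek _ _ q => pushCount q
  | .pop _ _ q => pushCount q
  | .load _ q => pushCount q
  | .branch _ q₁ q₂ => pushCount q₁ + pushCount q₂
  | .goto _ => 0
  | .halt => 0

theorem length_stk_stepAux_le {K Λ σ : Type*} {Γ : K → Type*} [DecidableEq K]
    (q : TM2.Stmt Γ Λ σ) (v : σ) (S : ∀ i, List (Γ i)) (i : K) :
    ((TM2.stepAux q v S).stk i).length ≤ (S i).length + pushCount q := by
  induction q generalizing v S with
  | push j f q ih =>
    refine (ih v _).trans ?_
    by_cases h : i = j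
    · subst h; simp [pushCount, Nat.add_assoc, Nat.add_comm 1]
    · simp [pushCount, h]
  | peek j f q ih => exact ih _ _
  | pop j f q ih =>
    refine (ih _ _).trans ?_
    by_cases h : i = j
    · subst h; simp [pushCount]
    · simp [pushCount, h]
  | load f q ih => exact ih _ _
  | branch f q₁ q₂ ih₁ ih₂ =>
    simp only [TM2.stepAux, pushCount]
    cases f v
    · exact (ih₂ v S).trans (by omega)
    · exact (ih₁ v S).trans (by omega)
  | goto f => simp [pushCount]
  | halt => simp [pushCount]

theorem iterate_bind_none {α : Type*} (f : α → Option α) (n : ℕ) :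
    (flip bind f)^[n] none = none := by
  induction n with
  | zero => rfl
  | succ n ih => exact ih

/-- A machine can write only boundedly many symbols in each step. -/
theorem exists_length_stk_le (T : FinTM2) : ∃ B, ∀ (n : ℕ) (c c' : T.Cfg) (i : T.K),
    (flip bind T.step)^[n] (some c) = some c' → (c'.stk i).length ≤ (c.stk i).length + B * n := by
  have := T.ΛFin
  obtain ⟨B, hB⟩ : ∃ B, ∀ l, pushCount (T.m l) ≤ B :=
    ⟨Finset.univ.sup fun l => pushCount (T.m l), fun l => Finset.le_sup (f := fun l =>
      pushCount (T.m l)) (Finset.mem_univ l)⟩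
  refine ⟨B, fun n => ?_⟩
  induction n with
  | zero =>
    rintro c c' i h
    obtain rfl : c = c' := by simpa using h
    simp
  | succ n ih =>
    rintro ⟨l, v, S⟩ c' i h
    rw [Function.iterate_succ_apply] at h
    cases l with
    | none =>
      have : (flip bind T.step)^[n] none = some c' := h
      exact absurd (this.symm.trans (iterate_bind_none _ n)) (Option.some_ne_none _)
    | some l =>
      refine (ih (TM2.stepAux (T.m l) v S) c' i h).trans ?_
      have h1 := length_stk_stepAux_le (T.m l) v S i
      have h2 := hB l
      change _ ≤ (S i).length + _
      rw [Nat.mul_succ]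
      omega

variable {k : ℕ} {T : FinTM2} {ei : T.Γ T.k₀ ≃ Bool} {eo : T.Γ T.k₁ ≃ Sym k} {acceptNil : Bool}

/-- The configuration of the simulating machine that corresponds to a configuration of `T`. -/
def liftCfg (c : TM2.Cfg T.Γ T.Λ T.σ) (s : SimState k T) (I : List Bool) (A B : List Cell)
    (Q : List (Cell × Cell)) : TM2.Cfg (SimΓ T) (SimLabel k T) (SimState k T) :=
  ⟨some (c.l.elim .rewind .run), { s with base := c.var }, simStk c.stk I A B Q⟩

/-- One step of `T` is one step of the simulating machine on the stacks of `T`. -/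
theorem stepAux_liftStmt (q : TM2.Stmt T.Γ T.Λ T.σ) (s : SimState k T) (S : ∀ i, List (T.Γ i))
    (I : List Bool) (A B : List Cell) (Q : List (Cell × Cell)) :
    TM2.stepAux (liftStmt T q) s (simStk S I A B Q) =
      liftCfg (TM2.stepAux q s.base S) s I A B Q := by
  induction q generalizing s S with
  | push j f q ih => simp [liftStmt, ih]
  | peek j f q ih => simp [liftStmt, ih, liftCfg]
  | pop j f q ih => simp [liftStmt, ih, liftCfg]
  | load f q ih => simp [liftStmt, ih, liftCfg]
  | branch f q₁ q₂ ih₁ ih₂ =>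
    simp only [liftStmt, TM2.stepAux, ih₁, ih₂]
    cases f s.base <;> rfl
  | goto f => simp [liftStmt, liftCfg]
  | halt => simp [liftStmt, liftCfg]

variable [NeZero k] [∀ i, Finite (T.Γ i)]

/-- The machine `T` is run until it halts. -/
theorem counts_run {I : List Bool} {A B : List Cell} {Q : List (Cell × Cell)}
    {t : ℕ} {a : ZMod k} (n : ℕ) (c c' : T.Cfg) (hc' : c'.l = none)
    (hn : (flip bind T.step)^[n] (some c) = some c') (s : SimState k T) (hs : s.acc = false)
    (h : ∀ s : SimState k T, s.acc = false →
      SimCounts ei eo acceptNil ⟨some .rewind, s, simStk c'.stk I A B Q⟩ t a) :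
    SimCounts ei eo acceptNil (liftCfg c s I A B Q) (t + n) a := by
  induction n generalizing c s with
  | zero =>
    obtain rfl : c = c' := by simpa using hn
    have := h { s with base := c.var } hs
    simpa [liftCfg, hc'] using this
  | succ n ih =>
    obtain ⟨l, v, S⟩ := c
    rw [Function.iterate_succ_apply] at hn
    cases l with
    | none =>
      have : (flip bind T.step)^[n] none = some c' := hn
      exact absurd (this.symm.trans (iterate_bind_none _ n)) (Option.some_ne_none _)
    | some l =>
      refine SimCounts.det (t := t + n) rfl ?_
      rw [stepAux_liftStmt]
      exact ih (TM2.stepAux (T.m l) v S) hn { s with base := v } hs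

/-- The input is copied in unary to the input stack of `T`, and bit by bit to both registers. -/
theorem counts_copy {B : List Cell} {Q : List (Cell × Cell)} {t : ℕ} {a : ZMod k}
    (I : List Bool) (A : List Cell) (m : ℕ) (s : SimState k T)
    (hs : s.acc = false) (hb : s.base = T.initialState)
    (h : ∀ s : SimState k T, s.acc = false → s.base = T.initialState →
      SimCounts ei eo acceptNil ⟨some (.run T.main), s,
        simStk (Function.update (fun _ => []) T.k₀ (List.replicate (m + I.length) (ei.symm true)))
          [] ((I.map fun b => (b, b)).reverse ++ A) B Q⟩ t a) :
    SimCounts ei eo acceptNil ⟨some .copy, s,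
      simStk (Function.update (fun _ => []) T.k₀ (List.replicate m (ei.symm true))) I A B Q⟩
      (t + I.length + 1) a := by
  induction I generalizing A m s with
  | nil =>
    refine SimCounts.det rfl ?_
    simpa using h { s with inp := none } hs hb
  | cons b I ih =>
    refine SimCounts.det rfl ?_
    have := ih ((b, b) :: A) (m + 1) { s with inp := some b } hs hb
      (by simpa [Nat.add_assoc, Nat.add_comm 1] using h)
    simpa [List.replicate_succ, Nat.add_assoc] using this

theorem initList_stk (T : FinTM2) (l : List (T.Γ T.k₀)) :
    (initList T l).stk = Function.update (fun _ => []) T.k₀ l := by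
  funext i
  by_cases h : i = T.k₀
  · subst h; simp [initList]
  · simp [initList, h]

theorem haltList_stk (T : FinTM2) (l : List (T.Γ T.k₁)) :
    (haltList T l).stk = Function.update (fun _ => []) T.k₁ l := by
  funext i
  by_cases h : i = T.k₁
  · subst h; simp [haltList]
  · simp [haltList, h]

theorem zip_self_eq_map {α : Type*} (l : List α) : l.zip l = l.map fun b => (b, b) := by
  induction l with
  | nil => rfl
  | cons a l ih => simp [ih]

/-- On a nonempty input `x`, the simulating machine counts the pairs of paths from `x` of the
circuit whose description `T` computes. -/
theorem counts_init {x : List Bool} (hx : x ≠ []) (C : Circuit k) (hC : C.WellFormed x.length)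
    {m : ℕ} (hT : TM2OutputsInTime T (List.replicate x.length (ei.symm true))
      (some ((Circuit.encode C).map eo.symm)) m) (E : ℕ) (hE : (Circuit.encode C).length ≤ E)
    (s : SimState k T) (hs : s.acc = false) (hb : s.base = T.initialState) :
    SimCounts ei eo acceptNil ⟨some .start, s, simStk (fun _ => []) x [] [] []⟩
      (E * (2 * (x.length + E) + 5) + 3 * x.length + E + m + 5)
      (pairSum (fun y => if y.getLast? = some true then 1 else 0) C x x) := by
  have hlen := Nat.mul_le_mul_right (2 * (x.length + E) + 5) hE
  have hm := hT.steps_le_m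
  refine SimCounts.mono (SimCounts.det (t := (Circuit.encode C).length * (2 * (x.length + E) + 5) +
    (x.length + E) + 2 + x.length + 1 + hT.steps + x.length + 1) rfl ?_) (by omega)
  have key : ∀ s : SimState k T, s.acc = false →
      SimCounts ei eo acceptNil ⟨some .rewind, s, simStk (outStk eo (Circuit.encode C)) []
        (x.map fun b => (b, b)).reverse [] []⟩ _ _ := fun s hs =>
    counts_rewind _ _ s hs fun s hs => by
      rw [List.reverse_reverse, List.append_nil, ← zip_self_eq_map]
      exact counts_circuit C x x rfl hC (x.length + E) (by omega) s hs
  have := counts_copy (ei := ei) (eo := eo) (acceptNil := acceptNil) (B := []) (Q := [])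
    x [] 0 { s with inp := x.head? } hs hb fun s hs hb => by
      have := counts_run (ei := ei) (eo := eo) (acceptNil := acceptNil) hT.steps _ _ rfl
        hT.evals_in_steps s hs (by rw [haltList_stk]; exact key)
      change SimCounts ei eo acceptNil ⟨some (.run T.main), { s with base := T.initialState },
        simStk (initList T _).stk _ _ _ _⟩ _ _ at this
      rw [initList_stk] at this
      simpa [← hb] using this
  obtain ⟨b, x, rfl⟩ := List.exists_cons_of_ne_nil hx
  simpa using this

/-- The description that `T` computes in `m` steps has length linear in the input and `m`. -/
theorem exists_length_output_le (T : FinTM2) : ∃ B, ∀ (l : List (T.Γ T.k₀)) (l' : List (T.Γ T.k₁))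
    (m : ℕ), TM2OutputsInTime T l (some l') m → l'.length ≤ l.length + B * m := by
  obtain ⟨B, hB⟩ := exists_length_stk_le T
  refine ⟨B, fun l l' m h => ?_⟩
  have h1 := hB h.steps _ _ T.k₁ h.evals_in_steps
  rw [haltList_stk, initList_stk, Function.update_self] at h1
  have h2 : (Function.update (fun i => ([] : List (T.Γ i))) T.k₀ l T.k₁).length ≤ l.length := by
    by_cases hk : T.k₁ = T.k₀
    · rw [hk, Function.update_self]
    · simp [hk]
  exact h1.trans (add_le_add h2 (Nat.mul_le_mul_left B h.steps_le_m))

/-- The refined inclusion: the number of accepting branches of the simulating machine is congruent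
to the characteristic function of the language. -/
theorem exists_sharpP_of_mem_GLP {k : ℕ} (hk : 2 ≤ k) {L : Language Bool} (hL : L ∈ GLP k) :
    ∃ f ∈ SharpP, ∀ x : List Bool,
      (x ∈ L → f x ≡ 1 [MOD k]) ∧ (x ∉ L → f x ≡ 0 [MOD k]) := by
  classical
  have : NeZero k := ⟨by omega⟩
  obtain ⟨C, ⟨⟨⟨T, ei, eo⟩, p, hT⟩, hΓ⟩, hC⟩ := hL
  dsimp only at hΓ hT
  obtain ⟨B, hB⟩ := exists_length_output_le T
  obtain ⟨acceptNil, hnil⟩ : ∃ b : Bool, b = true ↔ [] ∈ L := ⟨decide ([] ∈ L), decide_eq_true_iff⟩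
  let M := simulator ei eo acceptNil
  let E : Polynomial ℕ := .X + .C B * p
  let P : Polynomial ℕ := E * (2 * (.X + E) + 5) + 3 * .X + E + p + 5
  have key : ∀ x : List Bool, M.Counts k (M.init x) (P.eval x.length) (if x ∈ L then 1 else 0) := by
    intro x
    have hinit : M.init x = ⟨some .start, ⟨T.initialState, none, none, none, none, false⟩,
        simStk (fun _ => []) x [] [] []⟩ := by
      change TM2.Cfg.mk _ _ _ = TM2.Cfg.mk _ _ _
      congr 1
      funext i
      rcases i with i | (_ | _ | _ | _)
      · rfl
      · exact List.map_id x
      all_goals rfl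
    rw [hinit]
    change SimCounts ei eo acceptNil ⟨some .start, ⟨T.initialState, none, none, none, none, false⟩,
      simStk (fun _ => []) x [] [] []⟩ _ _
    -- The circuits start at `n = 1`; the empty input is decided by the built-in bit.
    obtain rfl | hx := eq_or_ne x []
    · refine SimCounts.mono (SimCounts.det (t := 0) rfl ?_) (by simp [P])
      have := SimCounts.halt (ei := ei) (eo := eo) (acceptNil := acceptNil)
        (s := ⟨T.initialState, none, none, none, none, acceptNil⟩) rfl
        (simStk (fun _ => []) [] [] [] []) 0
      simpa [hnil] using this
    · let n : ℕ+ := ⟨x.length, List.length_pos_iff.2 hx⟩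
      obtain ⟨hW, hn⟩ := hC n
      obtain ⟨ψ, hψ⟩ := hn x rfl
      have hTn := hT n
      simp only [List.map_replicate, List.length_replicate] at hTn
      rw [show (n : ℕ) = x.length from rfl] at hTn
      have := counts_init (ei := ei) (eo := eo) (acceptNil := acceptNil) hx (C n) hW hTn
        (E.eval x.length) (by
          have := hB _ _ _ hTn
          simpa [E] using this) ⟨T.initialState, none, none, none, none, false⟩ rfl rfl
      rw [pairSum_of_toLin_eq hW hψ] at this
      by_cases hxL : x ∈ L <;> simpa [P, hxL] using this
  refine ⟨fun x => (M.acceptingBranches x).ncard, ⟨M, P, fun x => (key x).bound, fun x => rfl⟩,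
    fun x => ⟨fun hx => ?_, fun hx => ?_⟩⟩
  · rw [← ZMod.natCast_eq_natCast_iff, Nat.cast_one]
    exact (key x).count.trans (if_pos hx)
  · rw [← ZMod.natCast_eq_natCast_iff, Nat.cast_zero]
    exact (key x).count.trans (if_neg hx)

end

end Modal

theorem lemma5p2 (k : ℕ) (hk : 2 ≤ k) :
    Modal.GLP k ⊆ Modal.ModP k ∧
      ∀ L ∈ Modal.GLP k, ∃ f ∈ Modal.SharpP, ∀ x : List Bool,
        (x ∈ L → f x ≡ 1 [MOD k]) ∧ (x ∉ L → f x ≡ 0 [MOD k]) := by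
  refine ⟨fun L hL => ?_, fun L hL => Modal.exists_sharpP_of_mem_GLP hk hL⟩
  obtain ⟨f, hf, h⟩ := Modal.exists_sharpP_of_mem_GLP hk hL
  refine ⟨f, hf, fun x => ⟨fun hx h0 => ?_, fun h0 => by_contra fun hx => h0 ((h x).2 hx)⟩⟩
  have h1 : 1 % k = 0 % k := ((h x).1 hx).symm.trans h0
  rw [Nat.mod_eq_of_lt (by omega), Nat.zero_mod] at h1
  exact one_ne_zero h1
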